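/- For $i,j\in\{0,1,2\}$ write $|i\pm j\rangle=(|i\rangle\pm|j\rangle)/\sqrt2$. The domino states are the nine product vectors of $\mathbb C^3\otimes\mathbb C^3$ $$|\psi_1\rangle=|1\rangle|1\rangle,\quad |\psi_{2,3}\rangle=|0\rangle|0\pm1\rangle,\quad |\psi_{4,5}\rangle=|2\rangle|1\pm2\rangle,\quad |\psi_{6,7}\rangle=|1\pm2\rangle|0\rangle,\quad |\psi_{8,9}\rangle=|0\pm1\rangle|2\rangle .$$ An LOCC protocol is a finite tree. At each inner node one of the two parties applies to its own system a non-destructive measurement, i.e. finitely many operators $M_1,\dots,M_k$ with a common finite-dimensional output space and $\sum_i M_i^\dagger M_i=I$, which may depend on all previous outcomes, and announces the outcome. At each leaf an outcome in $\{1,\dots,9\}$ is output. If $A_m\otimes B_m$ is the product of the measurement operators along the branch that ends in the leaf $m$, the LOCC measurement so performed has the POVM elements $E_j=\sum_m A_m^\dagger A_m\otimes B_m^\dagger B_m$, summed over the leaves $m$ with output $j$. A measurement $(E_j)_{j=1}^9$ is implemented by asymptotic LOCC if there is a sequence of LOCC protocols whose outcome probabilities converge, for every input state $\rho$, to $\operatorname{tr}(E_j\rho)$,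 $j=1,\dots,9$. The error probability of a nine-outcome measurement $(E_j)$ for discriminating the domino states is the probability that its outcome differs from $k$ when it is applied to $|\psi_k\rangle$ with $k$ uniformly random, i.e. $p_{\mathrm{error}}=\frac19\sum_{k}\sum_{j\neq k}\langle\psi_k|E_j|\psi_k\rangle$. Theorem. Every LOCC measurement, and more generally every measurement implemented by asymptotic LOCC, for discriminating the domino states errs with probability $$p_{\mathrm{error}}\ \ge\ 1.9\times10^{-8}.$$ In particular the domino states possess nonlocality without entanglement: the measurement with POVM elements $|\psi_k\rangle\langle\psi_k|$, $k=1,\dots,9$, is separable (each of its elements is a finite sum of tensor products of positive semidefinite operators) and discriminates the domino states with error probability $0$, but it cannot be implemented even by asymptotic LOCC. -/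

import Mathlib

open scoped Matrix Kronecker ComplexOrder

noncomputable section

/-- Operators on the bipartite space `ℂ^dA ⊗ ℂ^dB`, written in the standard product basis. -/
abbrev BipartiteOp (dA dB : ℕ) : Type :=
  Matrix (Fin dA × Fin dB) (Fin dA × Fin dB) ℂ

/-- A density operator: positive semidefinite with trace one. -/
def IsDensity {ν : Type*} [Fintype ν] (ρ : Matrix ν ν ℂ) : Prop :=
  ρ.PosSemidef ∧ ρ.trace = 1

/-- A POVM measurement: positive semidefinite operators that sum to the identity. -/
def IsPOVM {ι ν : Type*} [Fintype ι] [Fintype ν] [DecidableEq ν]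
    (E : ι → Matrix ν ν ℂ) : Prop :=
  (∀ i, (E i).PosSemidef) ∧ ∑ i, E i = 1

/-- The Born rule: the probability `tr (E ρ)` of the outcome with POVM element `E` on the
state `ρ` (this trace is real when both are positive semidefinite). -/
def bornProb {ν : Type*} [Fintype ν] (E ρ : Matrix ν ν ℂ) : ℝ :=
  (E * ρ).trace.re

/-- The rank-one operator `|ψ⟩⟨ψ|`. -/
def ketbra {ν : Type*} (ψ : ν → ℂ) : Matrix ν ν ℂ :=
  Matrix.vecMulVec ψ (star ψ)

/-- The probability that the measurement `E` errs in discriminating the states `ψ k`: an index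
`k` is drawn uniformly at random, `E` is applied to `ψ k`, and the outcome differs from `k`. -/
def errorProb {ι ν : Type*} [Fintype ι] [DecidableEq ι] [Fintype ν]
    (ψ : ι → ν → ℂ) (E : ι → Matrix ν ν ℂ) : ℝ :=
  ∑ k, (1 / (Fintype.card ι : ℝ)) * ∑ j with j ≠ k, bornProb (E j) (ketbra (ψ k))

/-- A separable measurement: a POVM each of whose elements is a finite sum of tensor products of
positive semidefinite operators. -/
def IsSeparableMeasurement {ι : Type*} [Fintype ι] {dA dB : ℕ}
    (E : ι → BipartiteOp dA dB) : Prop :=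
  IsPOVM E ∧ ∀ i, ∃ (r : ℕ) (a : Fin r → Matrix (Fin dA) (Fin dA) ℂ)
    (b : Fin r → Matrix (Fin dB) (Fin dB) ℂ),
    (∀ j, (a j).PosSemidef) ∧ (∀ j, (b j).PosSemidef) ∧ E i = ∑ j, a j ⊗ₖ b j

/-- A (finite-round) two-party LOCC protocol with outcomes in `ι`, started when Alice's system has
dimension `dA` and Bob's has dimension `dB`, as a finite tree. At an inner node the acting party
performs a non-destructive measurement `M 0, …, M (k - 1)` on her or his own system (with
`∑ i, (M i)ᴴ * M i = 1`, and an arbitrary output dimension `m`) and announces the outcome `i`; the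
protocol goes on with `next i`. At a leaf the protocol stops and outputs an element of `ι`. -/
inductive LOCCProtocol (ι : Type*) : ℕ → ℕ → Type _
  | output {dA dB : ℕ} (o : ι) : LOCCProtocol ι dA dB
  | alice {dA dB : ℕ} (k m : ℕ) (M : Fin k → Matrix (Fin m) (Fin dA) ℂ)
      (hM : ∑ i, (M i)ᴴ * M i = 1) (next : Fin k → LOCCProtocol ι m dB) : LOCCProtocol ι dA dB
  | bob {dA dB : ℕ} (k m : ℕ) (M : Fin k → Matrix (Fin m) (Fin dB) ℂ)
      (hM : ∑ i, (M i)ᴴ * M i = 1) (next : Fin k → LOCCProtocol ι dA m) : LOCCProtocol ι dA dB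

namespace LOCCProtocol

/-- `elementFrom j P A B` is the sum of `Aₘᴴ Aₘ ⊗ Bₘᴴ Bₘ` over the leaves of `P` with
output `j`, where `Aₘ ⊗ Bₘ` is the product of the measurement operators along the branch to the
leaf, applied after the operator `A ⊗ B` already implemented on reaching the root of `P`. -/
def elementFrom {ι : Type*} [DecidableEq ι] {dA dB : ℕ} (j : ι) :
    {a b : ℕ} → LOCCProtocol ι a b → Matrix (Fin a) (Fin dA) ℂ → Matrix (Fin b) (Fin dB) ℂ →
      BipartiteOp dA dB
  | _, _, output o, A, B => if o = j then (Aᴴ * A) ⊗ₖ (Bᴴ * B) else 0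
  | _, _, alice _ _ M _ next, A, B => ∑ i, elementFrom j (next i) (M i * A) B
  | _, _, bob _ _ M _ next, A, B => ∑ i, elementFrom j (next i) A (M i * B)

/-- The LOCC measurement carried out by a protocol: its POVM element for the outcome `j` is the sum
of `Aₘᴴ Aₘ ⊗ Bₘᴴ Bₘ` over all terminating measurement records `m` with output `j`. -/
def povm {ι : Type*} [DecidableEq ι] {dA dB : ℕ} (P : LOCCProtocol ι dA dB) (j : ι) :
    BipartiteOp dA dB :=
  elementFrom j P 1 1

end LOCCProtocol

/-- The measurement `E` can be implemented by asymptotic LOCC: there are finite-round LOCC protocols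
whose output distributions converge to that of `E` on every input state. -/
def ImplementedByAsymptoticLOCC {ι : Type*} [DecidableEq ι] {dA dB : ℕ}
    (E : ι → BipartiteOp dA dB) : Prop :=
  ∃ P : ℕ → LOCCProtocol ι dA dB, ∀ ρ : BipartiteOp dA dB, IsDensity ρ → ∀ j,
    Filter.Tendsto (fun t => bornProb ((P t).povm j) ρ) Filter.atTop (nhds (bornProb (E j) ρ))

/-- The standard basis vector `|i⟩` of `ℂ³`. -/
def ket (i : Fin 3) : Fin 3 → ℂ := Pi.single i 1

/-- `|i + j⟩ = (|i⟩ + |j⟩) / √2`. -/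
def ketAdd (i j : Fin 3) : Fin 3 → ℂ := ((√2 : ℝ) : ℂ)⁻¹ • (ket i + ket j)

/-- `|i - j⟩ = (|i⟩ - |j⟩) / √2`. -/
def ketSub (i j : Fin 3) : Fin 3 → ℂ := ((√2 : ℝ) : ℂ)⁻¹ • (ket i - ket j)

/-- The product vector `|α⟩|β⟩`. -/
def prodKet (α β : Fin 3 → ℂ) : Fin 3 × Fin 3 → ℂ := fun p => α p.1 * β p.2

/-- The nine domino states of `ℂ³ ⊗ ℂ³`. -/
def dominoState : Fin 9 → Fin 3 × Fin 3 → ℂ :=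
  ![prodKet (ket 1) (ket 1),
    prodKet (ket 0) (ketAdd 0 1), prodKet (ket 0) (ketSub 0 1),
    prodKet (ket 2) (ketAdd 1 2), prodKet (ket 2) (ketSub 1 2),
    prodKet (ketAdd 1 2) (ket 0), prodKet (ketSub 1 2) (ket 0),
    prodKet (ketAdd 0 1) (ket 2), prodKet (ketSub 0 1) (ket 2)]

end

/-! ### Real-variable estimates -/

/-! A branch carrying `A ⊗ B` is tracked only through the diagonals `x`, `y` of `Aᴴ * A` and `Bᴴ *
B`. Along the tree the total weight `T = (∑ x)(∑ y)` is additive, while `imbalance` is sublinear in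
the profile of the party who acts.

Disturbance costs error. For a pair such as `|0⟩|0 ± 1⟩`, a leaf misidentifies at least one member,
and Cauchy–Schwarz bounds the smaller weight below by a multiple of the squared overlap. In the
linearised form `2cδ - c²T`, with `δ` the imbalance, this passes from the leaves to every node
(`imbalance_le_errorWeight`). If `δ ≥ T/1000`, then `c = 1/1000` gives error weight at least `10⁻⁶
T`.

Without disturbance nothing is learned. While `δ < T/1000`, spread profiles stay spread: a segment
leading out of the spread region would meet its boundary, where so small an imbalance forces all
entries to be nearly equal, a contradiction (`isSpread_left_of_imbalance_lt` and its mirror). A leaf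
with spread profiles also has a large error, since some pair is missed entirely. So every node with
spread profiles has error weight at least `10⁻⁶ T` (`le_errorWeight`), and the root is such a node.
-/

/-- How far two diagonal profiles are from being compatible with the orthogonality of the four
pairs of domino states that share a basis vector. -/
noncomputable def imbalance (x y : Fin 3 → ℝ) : ℝ :=
  max (max (x 0 * |y 0 - y 1|) (x 2 * |y 1 - y 2|))
    (max (y 0 * |x 1 - x 2|) (y 2 * |x 0 - x 1|)) / 2

lemma imbalance_le_iff {x y : Fin 3 → ℝ} {r : ℝ} : imbalance x y ≤ r ↔
    (x 0 * |y 0 - y 1| ≤ 2 * r ∧ x 2 * |y 1 - y 2| ≤ 2 * r) ∧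
      (y 0 * |x 1 - x 2| ≤ 2 * r ∧ y 2 * |x 0 - x 1| ≤ 2 * r) := by
  rw [imbalance, div_le_iff₀ two_pos, mul_comm r, max_le_iff, max_le_iff, max_le_iff]

lemma imbalance_lt_iff {x y : Fin 3 → ℝ} {r : ℝ} : imbalance x y < r ↔
    (x 0 * |y 0 - y 1| < 2 * r ∧ x 2 * |y 1 - y 2| < 2 * r) ∧
      (y 0 * |x 1 - x 2| < 2 * r ∧ y 2 * |x 0 - x 1| < 2 * r) := by
  rw [imbalance, div_lt_iff₀ two_pos, mul_comm r, max_lt_iff, max_lt_iff, max_lt_iff]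

/-- For fixed `y ≥ 0` each term of the maximum is linear in `x` or a nonnegative multiple of the
absolute value of a linear form. Separate convexity in `x` and in `y` suffices, because only one
party acts at a time. -/
lemma imbalance_sum_left {ι : Type*} (s : Finset ι) (x : ι → Fin 3 → ℝ) {y : Fin 3 → ℝ}
    (hy : 0 ≤ y) : imbalance (∑ i ∈ s, x i) y ≤ ∑ i ∈ s, imbalance (x i) y := by
  have h := fun i => (imbalance_le_iff (x := x i) (y := y)).1 le_rfl
  have habs : ∀ j k : Fin 3, |∑ i ∈ s, x i j - ∑ i ∈ s, x i k| ≤ ∑ i ∈ s, |x i j - x i k| :=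
    fun j k => by rw [← Finset.sum_sub_distrib]; exact Finset.abs_sum_le_sum_abs _ _
  rw [imbalance_le_iff]
  simp only [Finset.sum_apply, Finset.mul_sum]
  refine ⟨⟨?_, ?_⟩, ?_, ?_⟩
  · rw [Finset.sum_mul]; exact Finset.sum_le_sum fun i _ => (h i).1.1
  · rw [Finset.sum_mul]; exact Finset.sum_le_sum fun i _ => (h i).1.2
  · refine (mul_le_mul_of_nonneg_left (habs 1 2) (hy 0)).trans ?_
    rw [Finset.mul_sum]; exact Finset.sum_le_sum fun i _ => (h i).2.1
  · refine (mul_le_mul_of_nonneg_left (habs 0 1) (hy 2)).trans ?_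
    rw [Finset.mul_sum]; exact Finset.sum_le_sum fun i _ => (h i).2.2

lemma imbalance_sum_right {ι : Type*} (s : Finset ι) {x : Fin 3 → ℝ} (y : ι → Fin 3 → ℝ)
    (hx : 0 ≤ x) : imbalance x (∑ i ∈ s, y i) ≤ ∑ i ∈ s, imbalance x (y i) := by
  have h := fun i => (imbalance_le_iff (x := x) (y := y i)).1 le_rfl
  have habs : ∀ j k : Fin 3, |∑ i ∈ s, y i j - ∑ i ∈ s, y i k| ≤ ∑ i ∈ s, |y i j - y i k| :=
    fun j k => by rw [← Finset.sum_sub_distrib]; exact Finset.abs_sum_le_sum_abs _ _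
  rw [imbalance_le_iff]
  simp only [Finset.sum_apply, Finset.mul_sum]
  refine ⟨⟨?_, ?_⟩, ?_, ?_⟩
  · refine (mul_le_mul_of_nonneg_left (habs 0 1) (hx 0)).trans ?_
    rw [Finset.mul_sum]; exact Finset.sum_le_sum fun i _ => (h i).1.1
  · refine (mul_le_mul_of_nonneg_left (habs 1 2) (hx 2)).trans ?_
    rw [Finset.mul_sum]; exact Finset.sum_le_sum fun i _ => (h i).1.2
  · rw [Finset.sum_mul]; exact Finset.sum_le_sum fun i _ => (h i).2.1
  · rw [Finset.sum_mul]; exact Finset.sum_le_sum fun i _ => (h i).2.2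

lemma imbalance_smul_left {t : ℝ} (ht : 0 ≤ t) (x y : Fin 3 → ℝ) :
    imbalance (t • x) y = t * imbalance x y := by
  simp only [imbalance, Pi.smul_apply, smul_eq_mul, ← mul_sub, abs_mul, abs_of_nonneg ht,
    mul_assoc, mul_left_comm _ t, ← mul_max_of_nonneg _ _ ht, mul_div_assoc]

lemma imbalance_smul_right {t : ℝ} (ht : 0 ≤ t) (x y : Fin 3 → ℝ) :
    imbalance x (t • y) = t * imbalance x y := by
  simp only [imbalance, Pi.smul_apply, smul_eq_mul, ← mul_sub, abs_mul, abs_of_nonneg ht,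
    mul_assoc, mul_left_comm _ t, ← mul_max_of_nonneg _ _ ht, mul_div_assoc]

/-! ### Spread profiles and why a small imbalance traps them -/

/-- The outer entries of a profile carry more than a sixth of its total weight each. -/
def IsSpread (x : Fin 3 → ℝ) : Prop :=
  (∑ i, x i) / 6 < x 0 ∧ (∑ i, x i) / 6 < x 2

/-- Near the boundary of the spread profiles a small imbalance forces a spread profile. -/
lemma isSpread_of_imbalance_lt {x y : Fin 3 → ℝ} (hX : 0 < ∑ i, x i) (hY : 0 < ∑ i, y i)
    (hx0 : (∑ i, x i) / 6 ≤ x 0) (hx2 : (∑ i, x i) / 6 ≤ x 2)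
    (hy0 : (∑ i, y i) / 6 ≤ y 0) (hy2 : (∑ i, y i) / 6 ≤ y 2)
    (h : imbalance x y < (1 / 1000) * ((∑ i, x i) * ∑ i, y i)) : IsSpread x ∧ IsSpread y := by
  obtain ⟨⟨h1, h2⟩, h3, h4⟩ := imbalance_lt_iff.1 h
  -- Dividing by an outer entry, at least a sixth of its sum, turns `2/1000` into `12/1000`:
  -- neighbouring entries of the other profile differ by less than 1.2% of its sum, so all entries
  -- are close to a third of it.
  have key : ∀ {u d S R : ℝ}, 0 < S → S / 6 ≤ u → u * |d| < 2 * (1 / 1000 * (S * R)) →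
      |d| < 12 / 1000 * R := by
    intro u d S R hS hu hd
    have : S / 6 * |d| ≤ u * |d| := mul_le_mul_of_nonneg_right hu (abs_nonneg d)
    by_contra! hc
    have := mul_le_mul_of_nonneg_left hc hS.le
    linarith
  have e1 := abs_lt.1 (key hX hx0 h1)
  have e2 := abs_lt.1 (key hX hx2 h2)
  rw [mul_comm (∑ i, x i)] at h3 h4
  have e3 := abs_lt.1 (key hY hy0 h3)
  have e4 := abs_lt.1 (key hY hy2 h4)
  simp only [IsSpread, Fin.sum_univ_three] at *
  refine ⟨⟨?_, ?_⟩, ?_, ?_⟩ <;> linarith [e1.1, e1.2, e2.1, e2.2, e3.1, e3.2, e4.1, e4.2]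

/-- A segment that starts at a spread profile and never meets the boundary of the spread
profiles ends at a spread profile. -/
lemma isSpread_of_segment {x x' : Fin 3 → ℝ} (hx : IsSpread x)
    (h : ∀ t ∈ Set.Icc (0 : ℝ) 1, ∀ z : Fin 3 → ℝ, z = (1 - t) • x + t • x' →
      (∑ i, z i) / 6 ≤ z 0 → (∑ i, z i) / 6 ≤ z 2 → IsSpread z) : IsSpread x' := by
  let z : ℝ → Fin 3 → ℝ := fun t => (1 - t) • x + t • x'
  let g : ℝ → ℝ := fun t => min (z t 0 - (∑ i, z t i) / 6) (z t 2 - (∑ i, z t i) / 6)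
  have hg : Continuous g := by
    simp only [g, z, Pi.add_apply, Pi.smul_apply, smul_eq_mul]
    fun_prop
  have hz1 : z 1 = x' := by simp [z]
  have hz0 : z 0 = x := by simp [z]
  by_contra hx'
  have hg1 : g 1 ≤ 0 := by
    by_contra! hc
    obtain ⟨h1, h2⟩ := lt_min_iff.1 hc
    rw [hz1] at h1 h2
    exact hx' ⟨by linarith, by linarith⟩
  have hg0 : 0 ≤ g 0 := by
    refine le_min ?_ ?_ <;> rw [hz0]
    · linarith [hx.1]
    · linarith [hx.2]
  -- A zero of `g` is a weakly spread point, so `h` makes it strictly spread, which contradicts `g t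
  -- = 0`.
  obtain ⟨t, ht, hgt⟩ := intermediate_value_Icc' zero_le_one hg.continuousOn ⟨hg1, hg0⟩
  have hl := min_le_left (z t 0 - (∑ i, z t i) / 6) (z t 2 - (∑ i, z t i) / 6)
  have hr := min_le_right (z t 0 - (∑ i, z t i) / 6) (z t 2 - (∑ i, z t i) / 6)
  have hgt' : min (z t 0 - (∑ i, z t i) / 6) (z t 2 - (∑ i, z t i) / 6) = 0 := hgt
  rw [hgt'] at hl hr
  have hs := h t ht (z t) rfl (by linarith) (by linarith)
  have : 0 < g t := lt_min (by linarith [hs.1]) (by linarith [hs.2])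
  linarith

lemma IsSpread.sum_pos {x : Fin 3 → ℝ} (hx : IsSpread x) (h : 0 ≤ x) : 0 < ∑ i, x i := by
  have h0 := h 0; have h1 := h 1; have h2 := h 2
  simp only [IsSpread, Fin.sum_univ_three, Pi.zero_apply] at *
  linarith [hx.1]

lemma imbalance_nonneg {x y : Fin 3 → ℝ} (hx : 0 ≤ x) : 0 ≤ imbalance x y :=
  div_nonneg (le_max_of_le_left (le_max_of_le_left (mul_nonneg (hx 0) (abs_nonneg _)))) two_pos.le

lemma sum_pos_of_imbalance_lt {x y : Fin 3 → ℝ} (hx : 0 ≤ x) (hy : 0 ≤ y) {c : ℝ}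
    (h : imbalance x y < c * ((∑ i, x i) * ∑ i, y i)) : 0 < ∑ i, x i ∧ 0 < ∑ i, y i := by
  have h0 := imbalance_nonneg (y := y) hx
  have hX : 0 ≤ ∑ i, x i := Finset.sum_nonneg fun i _ => hx i
  have hY : 0 ≤ ∑ i, y i := Finset.sum_nonneg fun i _ => hy i
  refine ⟨hX.lt_of_ne fun he => ?_, hY.lt_of_ne fun he => ?_⟩ <;>
  · rw [← he] at h; simp at h; linarith

lemma convexComb_pos {t a b : ℝ} (ht : t ∈ Set.Icc (0 : ℝ) 1) (ha : 0 < a) (hb : 0 < b) :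
    0 < (1 - t) * a + t * b := by
  rcases ht.2.lt_or_eq with h | rfl
  · exact add_pos_of_pos_of_nonneg (mul_pos (by linarith) ha) (mul_nonneg ht.1 hb.le)
  · simpa using hb

/-- By convexity the small imbalance at both endpoints persists along the segment from `x` to `x'`,
so the segment cannot cross the boundary. The discrete jump of a measurement is thus treated as a
continuous path. -/
lemma isSpread_left_of_imbalance_lt {x x' y : Fin 3 → ℝ} (hx : IsSpread x) (hy : IsSpread y)
    (hx0 : 0 ≤ x) (hx0' : 0 ≤ x') (hy0 : 0 ≤ y)
    (h : imbalance x y < (1 / 1000) * ((∑ i, x i) * ∑ i, y i))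
    (h' : imbalance x' y < (1 / 1000) * ((∑ i, x' i) * ∑ i, y i)) : IsSpread x' := by
  refine isSpread_of_segment hx fun t ht z hz hz0 hz2 => ?_
  have hX := (sum_pos_of_imbalance_lt hx0 hy0 h).1
  have hX' := (sum_pos_of_imbalance_lt hx0' hy0 h').1
  have hS : ∑ i, z i = (1 - t) * (∑ i, x i) + t * ∑ i, x' i := by
    simp [hz, Finset.sum_add_distrib, Finset.mul_sum]
  have hi := imbalance_sum_left Finset.univ ![(1 - t) • x, t • x'] hy0
  simp only [Fin.sum_univ_two, Matrix.cons_val_zero, Matrix.cons_val_one, ← hz] at hi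
  rw [imbalance_smul_left (by linarith [ht.2]), imbalance_smul_left ht.1] at hi
  refine (isSpread_of_imbalance_lt (y := y) ?_ (hy.sum_pos hy0) hz0 hz2 hy.1.le hy.2.le ?_).1
  · rw [hS]; exact convexComb_pos ht hX hX'
  · rw [hS]
    -- The slack `T/1000 - imbalance` is concave along the segment and positive at both ends.
    linarith [convexComb_pos ht (sub_pos.2 h) (sub_pos.2 h')]

lemma isSpread_right_of_imbalance_lt {x y y' : Fin 3 → ℝ} (hx : IsSpread x) (hy : IsSpread y)
    (hx0 : 0 ≤ x) (hy0 : 0 ≤ y) (hy0' : 0 ≤ y')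
    (h : imbalance x y < (1 / 1000) * ((∑ i, x i) * ∑ i, y i))
    (h' : imbalance x y' < (1 / 1000) * ((∑ i, x i) * ∑ i, y' i)) : IsSpread y' := by
  refine isSpread_of_segment hy fun t ht z hz hz0 hz2 => ?_
  have hY := (sum_pos_of_imbalance_lt hx0 hy0 h).2
  have hY' := (sum_pos_of_imbalance_lt hx0 hy0' h').2
  have hS : ∑ i, z i = (1 - t) * (∑ i, y i) + t * ∑ i, y' i := by
    simp [hz, Finset.sum_add_distrib, Finset.mul_sum]
  have hi := imbalance_sum_right Finset.univ ![(1 - t) • y, t • y'] hx0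
  simp only [Fin.sum_univ_two, Matrix.cons_val_zero, Matrix.cons_val_one, ← hz] at hi
  rw [imbalance_smul_right (by linarith [ht.2]), imbalance_smul_right ht.1] at hi
  refine (isSpread_of_imbalance_lt (x := x) (hx.sum_pos hx0) ?_ hx.1.le hx.2.le hz0 hz2 ?_).2
  · rw [hS]; exact convexComb_pos ht hY hY'
  · rw [hS]
    linarith [convexComb_pos ht (sub_pos.2 h) (sub_pos.2 h')]

/-- The two-state bound: `p` and `q` bound the error of guessing between two states whose
overlap is `d`. -/
lemma two_mul_sub_le_min {p q d T c : ℝ} (hp : 0 ≤ p) (hq : 0 ≤ q) (hpT : p ≤ T) (hqT : q ≤ T)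
    (hd : d ^ 2 ≤ p * q) : 2 * c * d - c ^ 2 * T ≤ min p q := by
  have main : ∀ {p q : ℝ}, 0 ≤ p → p ≤ T → q ≤ T → d ^ 2 ≤ p * q →
      2 * c * d - c ^ 2 * T ≤ p := by
    intro p q hp hpT hqT hd
    rcases (hp.trans hpT).eq_or_lt with rfl | hT
    · have h0 : p = 0 := le_antisymm hpT hp
      have : d = 0 := by
        rw [h0, zero_mul] at hd
        exact pow_eq_zero_iff two_ne_zero |>.1 (le_antisymm hd (sq_nonneg d))
      simp [this, hp]
    · have h1 : p * q ≤ p * T := mul_le_mul_of_nonneg_left hqT hp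
      refine le_of_mul_le_mul_right ?_ hT
      -- `p T ≥ p q ≥ d² ≥ 2cdT - c²T²`, then divide by `T`. The tangent-line bound replaces `d²/T`
      -- so that it can be summed over branches.
      nlinarith [sq_nonneg (d - c * T)]
  exact le_min (main hp hpT hqT hd) (main hq hqT hpT (by rwa [mul_comm]))

/-! ### Weights of product vectors -/

/-- The squared norm `‖A α‖²`. -/
noncomputable def weight {m n : ℕ} (A : Matrix (Fin m) (Fin n) ℂ) (α : Fin n → ℂ) : ℝ :=
  ‖(WithLp.toLp 2 (A *ᵥ α) : EuclideanSpace ℂ (Fin m))‖ ^ 2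

lemma weight_nonneg {m n : ℕ} (A : Matrix (Fin m) (Fin n) ℂ) (α : Fin n → ℂ) : 0 ≤ weight A α :=
  sq_nonneg _

lemma ofReal_weight {m n : ℕ} (A : Matrix (Fin m) (Fin n) ℂ) (α : Fin n → ℂ) :
    ((weight A α : ℝ) : ℂ) = (Aᴴ * A * ketbra α).trace := by
  rw [ketbra, Matrix.mul_vecMulVec, Matrix.trace_vecMulVec, ← Matrix.mulVec_mulVec,
    dotProduct_comm, Matrix.dotProduct_mulVec, ← Matrix.star_mulVec, weight,
    ← dotProduct_comm]
  have := inner_self_eq_norm_sq_to_K (𝕜 := ℂ)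
    (WithLp.toLp 2 (A *ᵥ α) : EuclideanSpace ℂ (Fin m))
  rw [EuclideanSpace.inner_toLp_toLp] at this
  rw [this]
  simp

lemma weight_one {n : ℕ} (α : Fin n → ℂ) :
    ((weight (1 : Matrix (Fin n) (Fin n) ℂ) α : ℝ) : ℂ) = (ketbra α).trace := by
  rw [ofReal_weight]; simp

/-- A complete measurement preserves the total weight. -/
lemma sum_weight_mul {k l m n : ℕ} {M : Fin k → Matrix (Fin l) (Fin m) ℂ}
    (hM : ∑ i, (M i)ᴴ * M i = 1) (A : Matrix (Fin m) (Fin n) ℂ) (α : Fin n → ℂ) :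
    ∑ i, weight (M i * A) α = weight A α := by
  have : ((∑ i, weight (M i * A) α : ℝ) : ℂ) = (weight A α : ℝ) := by
    push_cast
    simp_rw [ofReal_weight, Matrix.conjTranspose_mul]
    rw [← Matrix.trace_sum, ← Finset.sum_mul]
    congr 2
    calc ∑ i, Aᴴ * (M i)ᴴ * (M i * A) = Aᴴ * (∑ i, (M i)ᴴ * M i) * A := by
          rw [Matrix.mul_sum, Matrix.sum_mul]
          simp only [Matrix.mul_assoc]
      _ = Aᴴ * A := by rw [hM, Matrix.mul_one]
  exact_mod_cast this

lemma weight_ketAdd_add_ketSub {m : ℕ} (A : Matrix (Fin m) (Fin 3) ℂ) (i j : Fin 3) :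
    weight A (ketAdd i j) + weight A (ketSub i j) = weight A (ket i) + weight A (ket j) := by
  have h := parallelogram_law_with_norm ℂ
    (WithLp.toLp 2 (A *ᵥ ket i) : EuclideanSpace ℂ (Fin m)) (WithLp.toLp 2 (A *ᵥ ket j))
  simp only [weight, ketAdd, ketSub, Matrix.mulVec_smul, Matrix.mulVec_add, Matrix.mulVec_sub,
    WithLp.toLp_smul, WithLp.toLp_add, WithLp.toLp_sub, norm_smul, mul_pow]
  have h2 : ‖(((√2 : ℝ) : ℂ))⁻¹‖ ^ 2 = 1 / 2 := by
    rw [norm_inv, Complex.norm_real, inv_pow, Real.norm_eq_abs, sq_abs, Real.sq_sqrt two_pos.le,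
      one_div]
  rw [h2]
  linarith

/-- Cauchy–Schwarz for `A |i + j⟩` and `A |i - j⟩`. -/
lemma sq_weight_sub_weight_le {m : ℕ} (A : Matrix (Fin m) (Fin 3) ℂ) (i j : Fin 3) :
    ((weight A (ket i) - weight A (ket j)) / 2) ^ 2 ≤
      weight A (ketAdd i j) * weight A (ketSub i j) := by
  have h2 : ‖(((√2 : ℝ) : ℂ))⁻¹‖ ^ 2 = 1 / 2 := by
    rw [norm_inv, Complex.norm_real, inv_pow, Real.norm_eq_abs, sq_abs, Real.sq_sqrt two_pos.le,
      one_div]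
  simp only [weight, ketAdd, ketSub, Matrix.mulVec_smul, Matrix.mulVec_add, Matrix.mulVec_sub,
    WithLp.toLp_smul, WithLp.toLp_add, WithLp.toLp_sub, norm_smul, mul_pow, h2]
  generalize (WithLp.toLp 2 (A *ᵥ ket i) : EuclideanSpace ℂ (Fin m)) = u
  generalize (WithLp.toLp 2 (A *ᵥ ket j) : EuclideanSpace ℂ (Fin m)) = v
  have h : ‖u‖ ^ 2 - ‖v‖ ^ 2 = RCLike.re (inner ℂ (u + v) (u - v)) := by
    rw [inner_sub_right, inner_add_left, inner_add_left, map_sub, map_add, map_add,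
      inner_self_eq_norm_sq, inner_self_eq_norm_sq, inner_re_symm (𝕜 := ℂ) u v]
    ring
  have h3 : |‖u‖ ^ 2 - ‖v‖ ^ 2| ≤ ‖u + v‖ * ‖u - v‖ := by
    rw [h]; exact (RCLike.abs_re_le_norm _).trans (norm_inner_le_norm _ _)
  have h4 := pow_le_pow_left₀ (abs_nonneg _) h3 2
  rw [sq_abs, mul_pow] at h4
  linarith

lemma ketbra_prodKet (α β : Fin 3 → ℂ) : ketbra (prodKet α β) = ketbra α ⊗ₖ ketbra β := by
  ext p q
  simp [ketbra, prodKet, Matrix.vecMulVec_apply, Matrix.kroneckerMap_apply, mul_mul_mul_comm]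

lemma bornProb_kronecker {m n : ℕ} (A : Matrix (Fin m) (Fin 3) ℂ) (B : Matrix (Fin n) (Fin 3) ℂ)
    (α β : Fin 3 → ℂ) :
    bornProb ((Aᴴ * A) ⊗ₖ (Bᴴ * B)) (ketbra (prodKet α β)) = weight A α * weight B β := by
  rw [bornProb, ketbra_prodKet, ← Matrix.mul_kronecker_mul, Matrix.trace_kronecker,
    ← ofReal_weight, ← ofReal_weight, ← Complex.ofReal_mul, Complex.ofReal_re]

/-- Alice's factor of the domino states. -/
noncomputable def dominoLeft : Fin 9 → Fin 3 → ℂ :=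
  ![ket 1, ket 0, ket 0, ket 2, ket 2, ketAdd 1 2, ketSub 1 2, ketAdd 0 1, ketSub 0 1]

/-- Bob's factor of the domino states. -/
noncomputable def dominoRight : Fin 9 → Fin 3 → ℂ :=
  ![ket 1, ketAdd 0 1, ketSub 0 1, ketAdd 1 2, ketSub 1 2, ket 0, ket 0, ket 2, ket 2]

lemma dominoState_eq (k : Fin 9) : dominoState k = prodKet (dominoLeft k) (dominoRight k) := by
  fin_cases k <;> rfl

/-! ### Error weight along the protocol tree -/

lemma bornProb_sum_left {ι ν : Type*} [Fintype ν] (s : Finset ι) (E : ι → Matrix ν ν ℂ)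
    (ρ : Matrix ν ν ℂ) : bornProb (∑ i ∈ s, E i) ρ = ∑ i ∈ s, bornProb (E i) ρ := by
  simp [bornProb, Finset.sum_mul, Matrix.trace_sum]

/-- The total error weight of the sub-protocol `P` entered after the operator `A ⊗ B`. -/
noncomputable def errorWeight {a b : ℕ} (P : LOCCProtocol (Fin 9) a b)
    (A : Matrix (Fin a) (Fin 3) ℂ) (B : Matrix (Fin b) (Fin 3) ℂ) : ℝ :=
  ∑ k, ∑ j with j ≠ k, bornProb (P.elementFrom j A B) (ketbra (dominoState k))

lemma errorWeight_output {a b : ℕ} (o : Fin 9) (A : Matrix (Fin a) (Fin 3) ℂ)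
    (B : Matrix (Fin b) (Fin 3) ℂ) :
    errorWeight (LOCCProtocol.output o) A B =
      ∑ k with k ≠ o, weight A (dominoLeft k) * weight B (dominoRight k) := by
  rw [errorWeight, Finset.sum_filter]
  refine Finset.sum_congr rfl fun k _ => ?_
  rw [dominoState_eq, ← bornProb_kronecker, Finset.sum_filter,
    Finset.sum_eq_single o]
  · simp [LOCCProtocol.elementFrom, eq_comm]
  · intro j _ hj
    simp [LOCCProtocol.elementFrom, hj.symm, bornProb]
  · simp

lemma errorWeight_alice {a b k m : ℕ} (M : Fin k → Matrix (Fin m) (Fin a) ℂ)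
    (hM : ∑ i, (M i)ᴴ * M i = 1) (next : Fin k → LOCCProtocol (Fin 9) m b)
    (A : Matrix (Fin a) (Fin 3) ℂ) (B : Matrix (Fin b) (Fin 3) ℂ) :
    errorWeight (LOCCProtocol.alice k m M hM next) A B =
      ∑ i, errorWeight (next i) (M i * A) B := by
  simp only [errorWeight, LOCCProtocol.elementFrom, bornProb_sum_left]
  rw [Finset.sum_comm]
  refine Finset.sum_congr rfl fun l _ => Finset.sum_comm

lemma errorWeight_bob {a b k m : ℕ} (M : Fin k → Matrix (Fin m) (Fin b) ℂ)
    (hM : ∑ i, (M i)ᴴ * M i = 1) (next : Fin k → LOCCProtocol (Fin 9) a m)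
    (A : Matrix (Fin a) (Fin 3) ℂ) (B : Matrix (Fin b) (Fin 3) ℂ) :
    errorWeight (LOCCProtocol.bob k m M hM next) A B =
      ∑ i, errorWeight (next i) A (M i * B) := by
  simp only [errorWeight, LOCCProtocol.elementFrom, bornProb_sum_left]
  rw [Finset.sum_comm]
  refine Finset.sum_congr rfl fun l _ => Finset.sum_comm

/-! ### The error of a protocol -/

/-- The weights of the standard basis vectors, i.e. the diagonal of `Aᴴ * A`. -/
noncomputable def profile {m : ℕ} (A : Matrix (Fin m) (Fin 3) ℂ) : Fin 3 → ℝ :=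
  fun i => weight A (ket i)

lemma profile_nonneg {m : ℕ} (A : Matrix (Fin m) (Fin 3) ℂ) : 0 ≤ profile A :=
  fun _ => weight_nonneg _ _

lemma sum_profile_mul {k l m : ℕ} {M : Fin k → Matrix (Fin l) (Fin m) ℂ}
    (hM : ∑ i, (M i)ᴴ * M i = 1) (A : Matrix (Fin m) (Fin 3) ℂ) :
    ∑ i, profile (M i * A) = profile A := by
  ext j
  rw [Finset.sum_apply]
  exact sum_weight_mul hM A (ket j)

/-- The total weight of the domino states. -/
noncomputable def totalWeight (x y : Fin 3 → ℝ) : ℝ := (∑ i, x i) * ∑ i, y i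

lemma totalWeight_sum_left {ι : Type*} (s : Finset ι) (x : ι → Fin 3 → ℝ) (y : Fin 3 → ℝ) :
    totalWeight (∑ i ∈ s, x i) y = ∑ i ∈ s, totalWeight (x i) y := by
  simp only [totalWeight, Finset.sum_apply]
  rw [Finset.sum_comm, Finset.sum_mul]

lemma totalWeight_sum_right {ι : Type*} (s : Finset ι) (x : Fin 3 → ℝ) (y : ι → Fin 3 → ℝ) :
    totalWeight x (∑ i ∈ s, y i) = ∑ i ∈ s, totalWeight x (y i) := by
  simp only [totalWeight, Finset.sum_apply]
  rw [Finset.sum_comm, Finset.mul_sum]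

/-! ### Errors at a leaf -/

lemma add_le_errorWeight_output {a b : ℕ} {A : Matrix (Fin a) (Fin 3) ℂ}
    {B : Matrix (Fin b) (Fin 3) ℂ} {o k l : Fin 9} (hkl : k ≠ l) (hk : k ≠ o) (hl : l ≠ o) :
    weight A (dominoLeft k) * weight B (dominoRight k) +
      weight A (dominoLeft l) * weight B (dominoRight l) ≤
        errorWeight (LOCCProtocol.output o) A B := by
  rw [errorWeight_output, ← Finset.sum_pair
    (f := fun k => weight A (dominoLeft k) * weight B (dominoRight k)) hkl]
  refine Finset.sum_le_sum_of_subset_of_nonneg ?_ fun _ _ _ =>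
    mul_nonneg (weight_nonneg _ _) (weight_nonneg _ _)
  intro i hi
  rcases Finset.mem_insert.1 hi with rfl | hi
  · simpa using hk
  · rw [Finset.mem_singleton.1 hi]; simpa using hl

/-- The announced outcome is correct for at most one of the two states, so the other contributes its
full weight. -/
lemma min_le_errorWeight_output {a b : ℕ} (A : Matrix (Fin a) (Fin 3) ℂ)
    (B : Matrix (Fin b) (Fin 3) ℂ) (o : Fin 9) {k l : Fin 9} (hkl : k ≠ l) :
    min (weight A (dominoLeft k) * weight B (dominoRight k))
      (weight A (dominoLeft l) * weight B (dominoRight l)) ≤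
        errorWeight (LOCCProtocol.output o) A B := by
  rw [errorWeight_output]
  have h : ∀ k, k ≠ o → weight A (dominoLeft k) * weight B (dominoRight k) ≤
      ∑ k with k ≠ o, weight A (dominoLeft k) * weight B (dominoRight k) := fun k hk =>
    Finset.single_le_sum
      (f := fun k => weight A (dominoLeft k) * weight B (dominoRight k))
      (fun _ _ => mul_nonneg (weight_nonneg _ _) (weight_nonneg _ _)) (by simpa using hk)
  by_cases hk : k = o
  · exact (min_le_right _ _).trans (h l (hk ▸ hkl.symm))
  · exact (min_le_left _ _).trans (h k hk)

/-- The two-state bound for a pair `|γ⟩|i ± j⟩`, with `w` the weight of `γ`. -/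
lemma pair_bound {n : ℕ} (B : Matrix (Fin n) (Fin 3) ℂ) (i j : Fin 3) {w T c : ℝ} (hw : 0 ≤ w)
    (hT : w * (weight B (ket i) + weight B (ket j)) ≤ T) :
    c * (w * |weight B (ket i) - weight B (ket j)|) - c ^ 2 * T ≤
      min (w * weight B (ketAdd i j)) (w * weight B (ketSub i j)) := by
  have hs := weight_ketAdd_add_ketSub B i j
  have hp := weight_nonneg B (ketAdd i j)
  have hq := weight_nonneg B (ketSub i j)
  have hcs := sq_weight_sub_weight_le B i j
  have h := two_mul_sub_le_min (p := w * weight B (ketAdd i j)) (q := w * weight B (ketSub i j))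
    (d := w * |weight B (ket i) - weight B (ket j)| / 2) (T := T) (c := c)
    (mul_nonneg hw hp) (mul_nonneg hw hq)
    ((mul_le_mul_of_nonneg_left (by linarith) hw).trans hT)
    ((mul_le_mul_of_nonneg_left (by linarith) hw).trans hT) (by
      have := mul_le_mul_of_nonneg_left hcs (sq_nonneg w)
      rw [div_pow, mul_pow, sq_abs]
      linarith)
  linarith

lemma mul_add_le_totalWeight {x y : Fin 3 → ℝ} (hx : 0 ≤ x) (hy : 0 ≤ y) {i j k : Fin 3}
    (hjk : j ≠ k) : x i * (y j + y k) ≤ totalWeight x y := by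
  refine mul_le_mul (Finset.single_le_sum (fun i _ => hx i) (Finset.mem_univ i)) ?_
    (add_nonneg (hy j) (hy k)) (Finset.sum_nonneg fun i _ => hx i)
  rw [← Finset.sum_pair hjk]
  exact Finset.sum_le_sum_of_subset_of_nonneg (Finset.subset_univ _) fun i _ _ => hy i

lemma totalWeight_comm (x y : Fin 3 → ℝ) : totalWeight x y = totalWeight y x := mul_comm _ _

lemma imbalance_le_errorWeight_output {a b : ℕ} (A : Matrix (Fin a) (Fin 3) ℂ)
    (B : Matrix (Fin b) (Fin 3) ℂ) (o : Fin 9) {c : ℝ} (hc : 0 < c) :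
    2 * c * imbalance (profile A) (profile B) - c ^ 2 * totalWeight (profile A) (profile B) ≤
      errorWeight (LOCCProtocol.output o) A B := by
  have hA := profile_nonneg A
  have hB := profile_nonneg B
  suffices h : imbalance (profile A) (profile B) ≤ (errorWeight (LOCCProtocol.output o) A B +
      c ^ 2 * totalWeight (profile A) (profile B)) / (2 * c) by
    rw [le_div_iff₀ (by positivity)] at h
    linarith
  have hr : ∀ {d : ℝ}, c * d - c ^ 2 * totalWeight (profile A) (profile B) ≤
      errorWeight (LOCCProtocol.output o) A B → d ≤ 2 * ((errorWeight (LOCCProtocol.output o) A B +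
      c ^ 2 * totalWeight (profile A) (profile B)) / (2 * c)) := by
    intro d hd
    rw [← div_le_iff₀' two_pos, le_div_iff₀ (by positivity)]
    linarith
  refine imbalance_le_iff.2 ⟨⟨hr ?_, hr ?_⟩, hr ?_, hr ?_⟩
  · refine (pair_bound B 0 1 (hA 0) (mul_add_le_totalWeight hA hB (by decide))).trans ?_
    exact min_le_errorWeight_output A B o (k := 1) (l := 2) (by decide)
  · refine (pair_bound B 1 2 (hA 2) (mul_add_le_totalWeight hA hB (by decide))).trans ?_
    exact min_le_errorWeight_output A B o (k := 3) (l := 4) (by decide)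
  · rw [totalWeight_comm]
    refine (pair_bound A 1 2 (hB 0) (mul_add_le_totalWeight hB hA (by decide))).trans ?_
    rw [mul_comm, mul_comm (profile B 0)]
    exact min_le_errorWeight_output A B o (k := 5) (l := 6) (by decide)
  · rw [totalWeight_comm]
    refine (pair_bound A 0 1 (hB 2) (mul_add_le_totalWeight hB hA (by decide))).trans ?_
    rw [mul_comm, mul_comm (profile B 2)]
    exact min_le_errorWeight_output A B o (k := 7) (l := 8) (by decide)

/-- Once the orthogonality of a pair of domino states is disturbed, errors are unavoidable. -/
theorem imbalance_le_errorWeight {c : ℝ} (hc : 0 < c) {a b : ℕ} (P : LOCCProtocol (Fin 9) a b)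
    (A : Matrix (Fin a) (Fin 3) ℂ) (B : Matrix (Fin b) (Fin 3) ℂ) :
    2 * c * imbalance (profile A) (profile B) - c ^ 2 * totalWeight (profile A) (profile B) ≤
      errorWeight P A B := by
  induction P with
  | output o => exact imbalance_le_errorWeight_output A B o hc
  | alice k m M hM next ih =>
    rw [errorWeight_alice]
    refine le_trans ?_ (Finset.sum_le_sum fun i _ => ih i (M i * A) B)
    -- The children's total weights add up to that of the node, and their imbalances add up to at
    -- least that of the node.
    rw [Finset.sum_sub_distrib, ← Finset.mul_sum, ← Finset.mul_sum, ← totalWeight_sum_left,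
      sum_profile_mul hM]
    have := imbalance_sum_left Finset.univ (fun i => profile (M i * A)) (profile_nonneg B)
    rw [sum_profile_mul hM] at this
    gcongr
  | bob k m M hM next ih =>
    rw [errorWeight_bob]
    refine le_trans ?_ (Finset.sum_le_sum fun i _ => ih i A (M i * B))
    rw [Finset.sum_sub_distrib, ← Finset.mul_sum, ← Finset.mul_sum, ← totalWeight_sum_right,
      sum_profile_mul hM]
    have := imbalance_sum_right Finset.univ (fun i => profile (M i * B)) (profile_nonneg A)
    rw [sum_profile_mul hM] at this
    gcongr

lemma le_errorWeight_of_le_imbalance {a b : ℕ} (P : LOCCProtocol (Fin 9) a b)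
    (A : Matrix (Fin a) (Fin 3) ℂ) (B : Matrix (Fin b) (Fin 3) ℂ)
    (h : 1 / 1000 * totalWeight (profile A) (profile B) ≤ imbalance (profile A) (profile B)) :
    (1 / 1000) ^ 2 * totalWeight (profile A) (profile B) ≤ errorWeight P A B := by
  -- With imbalance at least `cT`, the bound becomes `2c²T - c²T = c²T`.
  have := imbalance_le_errorWeight (c := 1 / 1000) (by norm_num) P A B
  linarith

/-- One of the pairs on `|0⟩` and `|2⟩` does not contain the announced state and is missed entirely.
Its two weights sum to at least `x₀ y₀` or `x₂ y₂`, hence exceed `T/36`. -/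
lemma le_errorWeight_output {a b : ℕ} (o : Fin 9) (A : Matrix (Fin a) (Fin 3) ℂ)
    (B : Matrix (Fin b) (Fin 3) ℂ) (hA : IsSpread (profile A)) (hB : IsSpread (profile B)) :
    (1 / 1000) ^ 2 * totalWeight (profile A) (profile B) ≤
      errorWeight (LOCCProtocol.output o) A B := by
  have hX := hA.sum_pos (profile_nonneg A)
  have hY := hB.sum_pos (profile_nonneg B)
  have hB1 := profile_nonneg B 1
  have key : ∀ {u v S R : ℝ}, 0 < S → 0 < R → S / 6 < u → R / 6 < v →
      (1 / 1000) ^ 2 * (S * R) ≤ u * v := by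
    intro u v S R hS hR hu hv
    have h1 := mul_le_mul hu.le hv.le (by positivity) (by linarith)
    have h2 : 0 < S * R := mul_pos hS hR
    linarith
  by_cases ho : o = 1 ∨ o = 2
  · refine (key hX hY hA.2 hB.2).trans ?_
    refine le_trans ?_ (add_le_errorWeight_output (k := 3) (l := 4) (by decide)
      (by rcases ho with rfl | rfl <;> decide) (by rcases ho with rfl | rfl <;> decide))
    change _ ≤ profile A 2 * weight B (ketAdd 1 2) + profile A 2 * weight B (ketSub 1 2)
    rw [← mul_add, weight_ketAdd_add_ketSub]
    exact mul_le_mul_of_nonneg_left (le_add_of_nonneg_left hB1) (profile_nonneg A 2)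
  · push Not at ho
    refine (key hX hY hA.1 hB.1).trans ?_
    refine le_trans ?_ (add_le_errorWeight_output (k := 1) (l := 2) (by decide)
      ho.1.symm ho.2.symm)
    change _ ≤ profile A 0 * weight B (ketAdd 0 1) + profile A 0 * weight B (ketSub 0 1)
    rw [← mul_add, weight_ketAdd_add_ketSub]
    exact mul_le_mul_of_nonneg_left (le_add_of_nonneg_right hB1) (profile_nonneg A 0)

/-- A protocol entered with spread profiles either stops there or has to cross a region where
the orthogonality of the domino states is disturbed. -/
theorem le_errorWeight {a b : ℕ} (P : LOCCProtocol (Fin 9) a b)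
    (A : Matrix (Fin a) (Fin 3) ℂ) (B : Matrix (Fin b) (Fin 3) ℂ)
    (hA : IsSpread (profile A)) (hB : IsSpread (profile B)) :
    (1 / 1000) ^ 2 * totalWeight (profile A) (profile B) ≤ errorWeight P A B := by
  induction P with
  | output o => exact le_errorWeight_output o A B hA hB
  | alice k m M hM next ih =>
    rcases le_or_gt (1 / 1000 * totalWeight (profile A) (profile B))
      (imbalance (profile A) (profile B)) with h | h
    · exact le_errorWeight_of_le_imbalance _ A B h
    rw [errorWeight_alice, ← sum_profile_mul hM A, totalWeight_sum_left, Finset.mul_sum]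
    refine Finset.sum_le_sum fun i _ => ?_
    -- A child with large imbalance is settled without being spread; this covers children of zero
    -- weight. Any other child is still spread, and induction applies.
    rcases le_or_gt (1 / 1000 * totalWeight (profile (M i * A)) (profile B))
      (imbalance (profile (M i * A)) (profile B)) with h' | h'
    · exact le_errorWeight_of_le_imbalance _ _ B h'
    · exact ih i _ B (isSpread_left_of_imbalance_lt hA hB (profile_nonneg _) (profile_nonneg _)
        (profile_nonneg _) h h') hB
  | bob k m M hM next ih =>
    rcases le_or_gt (1 / 1000 * totalWeight (profile A) (profile B))
      (imbalance (profile A) (profile B)) with h | h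
    · exact le_errorWeight_of_le_imbalance _ A B h
    rw [errorWeight_bob, ← sum_profile_mul hM B, totalWeight_sum_right, Finset.mul_sum]
    refine Finset.sum_le_sum fun i _ => ?_
    rcases le_or_gt (1 / 1000 * totalWeight (profile A) (profile (M i * B)))
      (imbalance (profile A) (profile (M i * B))) with h' | h'
    · exact le_errorWeight_of_le_imbalance _ A _ h'
    · exact ih i A _ hA (isSpread_right_of_imbalance_lt hA hB (profile_nonneg _)
        (profile_nonneg _) (profile_nonneg _) h h')

lemma trace_ketbra_ket (i : Fin 3) : (ketbra (ket i)).trace = 1 := by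
  simp [ketbra, ket, Matrix.trace_vecMulVec, Pi.star_single]

lemma profile_one : profile (1 : Matrix (Fin 3) (Fin 3) ℂ) = 1 := by
  ext i
  have : weight (1 : Matrix (Fin 3) (Fin 3) ℂ) (ket i) = 1 := by
    have h := weight_one (ket i)
    rw [trace_ketbra_ket] at h
    exact_mod_cast h
  exact this

theorem le_errorProb_povm (P : LOCCProtocol (Fin 9) 3 3) :
    (1.9 : ℝ) * 10 ^ (-8 : ℤ) ≤ errorProb dominoState P.povm := by
  have hs : IsSpread (profile (1 : Matrix (Fin 3) (Fin 3) ℂ)) := by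
    rw [profile_one]; constructor <;> norm_num
  -- At the root `T = 9`, which cancels the prior `1/9`: the error is in fact at least `10⁻⁶`.
  have h := le_errorWeight P 1 1 hs hs
  have he : errorProb dominoState P.povm = 1 / 9 * errorWeight P 1 1 := by
    rw [errorProb, errorWeight, Finset.mul_sum]
    simp [LOCCProtocol.povm]
  rw [profile_one] at h
  rw [he]
  norm_num [totalWeight] at h ⊢
  linarith

/-! ### Asymptotic LOCC and the domino measurement -/

lemma inv_sqrt_two_mul_self : (((√2 : ℝ) : ℂ))⁻¹ * (((√2 : ℝ) : ℂ))⁻¹ = 1 / 2 := by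
  rw [← mul_inv, ← Complex.ofReal_mul, Real.mul_self_sqrt two_pos.le]; simp

lemma ketbra_posSemidef {ν : Type*} [Finite ν] (ψ : ν → ℂ) : (ketbra ψ).PosSemidef :=
  Matrix.posSemidef_vecMulVec_self_star ψ

lemma ketbra_ketAdd_add_ketbra_ketSub (i j : Fin 3) :
    ketbra (ketAdd i j) + ketbra (ketSub i j) = ketbra (ket i) + ketbra (ket j) := by
  ext a b
  simp only [ketbra, ketAdd, ketSub, Matrix.add_apply, Matrix.vecMulVec_apply, Pi.smul_apply,
    Pi.add_apply, Pi.sub_apply, Pi.star_apply, star_smul, smul_eq_mul, star_add, star_sub,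
    star_inv₀, Complex.star_def, Complex.conj_ofReal]
  linear_combination (2 * ket i a * (starRingEnd ℂ) (ket i b) +
    2 * ket j a * (starRingEnd ℂ) (ket j b)) * inv_sqrt_two_mul_self

lemma trace_ketbra_ketAdd {i j : Fin 3} (hij : i ≠ j) : (ketbra (ketAdd i j)).trace = 1 := by
  simp [ketbra, ketAdd, ket, Matrix.trace_vecMulVec, Pi.star_single, hij, hij.symm]
  linear_combination 2 * inv_sqrt_two_mul_self

lemma trace_ketbra_ketSub {i j : Fin 3} (hij : i ≠ j) : (ketbra (ketSub i j)).trace = 1 := by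
  simp [ketbra, ketSub, ket, Matrix.trace_vecMulVec, Pi.star_single, hij, hij.symm]
  linear_combination 2 * inv_sqrt_two_mul_self

lemma sum_ketbra_ket : ketbra (ket 0) + ketbra (ket 1) + ketbra (ket 2) = 1 := by
  ext i j
  fin_cases i <;> fin_cases j <;> simp [ketbra, ket, Matrix.vecMulVec_apply]

/-- Each pair `±` projects onto the same plane as its two basis products, and the centre and the
four dominoes tile the 3 × 3 grid. -/
lemma sum_ketbra_dominoState : ∑ k, ketbra (dominoState k) = 1 := by
  have h : ∑ k, ketbra (dominoState k) = ketbra (ket 1) ⊗ₖ ketbra (ket 1) +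
      ketbra (ket 0) ⊗ₖ (ketbra (ketAdd 0 1) + ketbra (ketSub 0 1)) +
      ketbra (ket 2) ⊗ₖ (ketbra (ketAdd 1 2) + ketbra (ketSub 1 2)) +
      (ketbra (ketAdd 1 2) + ketbra (ketSub 1 2)) ⊗ₖ ketbra (ket 0) +
      (ketbra (ketAdd 0 1) + ketbra (ketSub 0 1)) ⊗ₖ ketbra (ket 2) := by
    rw [Fin.sum_univ_castSucc, Fin.sum_univ_eight]
    simp only [dominoState_eq, ketbra_prodKet, Matrix.kronecker_add, Matrix.add_kronecker]
    simp [dominoLeft, dominoRight]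
    abel
  rw [h]
  simp only [ketbra_ketAdd_add_ketbra_ketSub]
  rw [← Matrix.one_kronecker_one, ← sum_ketbra_ket]
  simp only [Matrix.kronecker_add, Matrix.add_kronecker]
  abel

lemma isDensity_ketbra_dominoState (k : Fin 9) : IsDensity (ketbra (dominoState k)) := by
  refine ⟨ketbra_posSemidef _, ?_⟩
  rw [dominoState_eq, ketbra_prodKet, Matrix.trace_kronecker]
  fin_cases k <;> simp [dominoLeft, dominoRight, trace_ketbra_ket, trace_ketbra_ketAdd,
    trace_ketbra_ketSub]

lemma bornProb_ketbra_self {ν : Type*} [Fintype ν] {ψ : ν → ℂ} (h : (ketbra ψ).trace = 1) :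
    bornProb (ketbra ψ) (ketbra ψ) = 1 := by
  have h' : star ψ ⬝ᵥ ψ = 1 := by rwa [ketbra, Matrix.trace_vecMulVec, dotProduct_comm] at h
  have : ketbra ψ * ketbra ψ = ketbra ψ := by
    simp [ketbra, Matrix.vecMulVec_mul_vecMulVec, h']
  rw [bornProb, this, h, Complex.one_re]

/-- For each input the outcome probabilities sum to `1`, and the correct outcome already has
probability `1`. -/
lemma errorProb_ketbra_dominoState :
    errorProb dominoState (fun k => ketbra (dominoState k)) = 0 := by
  refine Finset.sum_eq_zero fun k _ => mul_eq_zero_of_right _ ?_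
  have hk := (isDensity_ketbra_dominoState k).2
  have h := bornProb_sum_left Finset.univ (fun j => ketbra (dominoState j))
    (ketbra (dominoState k))
  rw [sum_ketbra_dominoState, bornProb, one_mul, hk, Complex.one_re,
    ← Finset.add_sum_erase _ _ (Finset.mem_univ k), bornProb_ketbra_self hk] at h
  rw [Finset.filter_ne']
  linarith

lemma isSeparableMeasurement_ketbra_dominoState :
    IsSeparableMeasurement (fun k => ketbra (dominoState k)) := by
  refine ⟨⟨fun k => ketbra_posSemidef _, sum_ketbra_dominoState⟩, fun k =>
    ⟨1, fun _ => ketbra (dominoLeft k), fun _ => ketbra (dominoRight k),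
      fun _ => ketbra_posSemidef _, fun _ => ketbra_posSemidef _, ?_⟩⟩
  simp [dominoState_eq, ketbra_prodKet]

/-- The error is a finite linear combination of outcome probabilities on the domino states, so it
converges along the sequence, and the uniform bound survives the limit. -/
theorem le_errorProb_of_implementedByAsymptoticLOCC {E : Fin 9 → BipartiteOp 3 3}
    (hE : ImplementedByAsymptoticLOCC E) :
    (1.9 : ℝ) * 10 ^ (-8 : ℤ) ≤ errorProb dominoState E := by
  obtain ⟨P, hP⟩ := hE
  have h : Filter.Tendsto (fun t => errorProb dominoState (P t).povm) Filter.atTop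
      (nhds (errorProb dominoState E)) :=
    tendsto_finsetSum _ fun k _ => (tendsto_finsetSum _ fun j _ =>
      hP _ (isDensity_ketbra_dominoState k) j).const_mul _
  exact ge_of_tendsto' h fun t => le_errorProb_povm (P t)

theorem mainTheorem3 :
    -- every LOCC measurement errs with probability at least `1.9 × 10⁻⁸`
    (∀ P : LOCCProtocol (Fin 9) 3 3,
      (1.9 : ℝ) * 10 ^ (-8 : ℤ) ≤ errorProb dominoState P.povm) ∧
    -- and so does every measurement implemented by asymptotic LOCC
    (∀ E : Fin 9 → BipartiteOp 3 3, IsPOVM E → ImplementedByAsymptoticLOCC E →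
      (1.9 : ℝ) * 10 ^ (-8 : ℤ) ≤ errorProb dominoState E) ∧
    -- nonlocality without entanglement: the measurement in the domino basis is separable and
    -- never errs, but it cannot be implemented even by asymptotic LOCC
    (IsSeparableMeasurement (fun k => ketbra (dominoState k)) ∧
      errorProb dominoState (fun k => ketbra (dominoState k)) = 0 ∧
      ¬ ImplementedByAsymptoticLOCC (fun k => ketbra (dominoState k))) := by
  refine ⟨le_errorProb_povm, fun E _ hE => le_errorProb_of_implementedByAsymptoticLOCC hE,
    isSeparableMeasurement_ketbra_dominoState, errorProb_ketbra_dominoState, fun h => ?_⟩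
  have := le_errorProb_of_implementedByAsymptoticLOCC h
  rw [errorProb_ketbra_dominoState] at this
  norm_num at this
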